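/- Let $(X,Y)$ be a random vector with values in $[0,\infty)^2$, and let the Markov transition kernel $K$ on $[0,\infty)$ be a version of the conditional distribution of $X$ given $Y$, i.e. $P[X\in A\mid Y=y]=K(y,A)$. Let $G$ be a probability measure on $[0,\infty)$, with distribution function also written $G(u)=G([0,u])$. Suppose that, as $t\to\infty$, $$t\,P[Y>ty]\to y^{-1}\quad\text{for every } y>0,\qquad\text{and}\qquad K(t,t\,\cdot\,)\Rightarrow G\ \text{ weakly on } [0,\infty].$$ Then there is a Radon measure $\mu$ on $[0,\infty]\times(0,\infty]$ such that, as $t\to\infty$, $$t\,P[(X,Y)\in t\,\cdot\,]\to\mu\quad\text{vaguely on } [0,\infty]\times(0,\infty],$$ that is, integrals of continuous functions with compact support converge. For all $x,y\in(0,\infty)$, and a random variable $\xi$ with distribution $G$, it satisfies $$\mu([0,x]\times(y,\infty])=\int_y^\infty G(x/u)\,u^{-2}\,du=\frac1x\int_0^{x/y}G(u)\,du=\frac1y P\Big[\xi\le\frac xy\Big]-\frac1x E\big[\xi\,1_{\{\xi\le x/y\}}\big].$$ If moreover $G\neq\delta_0$, the unit mass at $0$, then $\mu$ is conditionally non-degenerate: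 for every $y\in(0,\infty)$ the measure $\mu(\,\cdot\,\times(y,\infty])$ on $[0,\infty]$ is not concentrated at a single point, and $\mu(\{\infty\}\times(y,\infty])=0$. -/

import Mathlib

open MeasureTheory ProbabilityTheory Filter Topology
open scoped NNReal ENNReal

/-- The state space `[0,∞] × (0,∞]`. -/
abbrev ExtCone : Type := ℝ≥0∞ × Set.Ioi (0 : ℝ≥0∞)

/-- Vague convergence of measures: convergence of the integrals of all continuous real functions
with compact support. -/
def VagueTendsto {ι E : Type*} [TopologicalSpace E] [MeasurableSpace E]
    (ν : ι → Measure E) (l : Filter ι) (μ : Measure E) : Prop :=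
  ∀ f : E → ℝ, Continuous f → HasCompactSupport f →
    Tendsto (fun i => ∫ p, f p ∂(ν i)) l (𝓝 (∫ p, f p ∂μ))

/-- The law of `Y` is in the standardized domain of attraction:
`t P[Y > t y] → 1 / y` as `t → ∞`, for every `y > 0`. -/
def InStdDomain {Ω : Type*} [MeasurableSpace Ω] (P : Measure Ω) (Y : Ω → ℝ≥0) : Prop :=
  ∀ y : ℝ≥0, 0 < y →
    Tendsto (fun t : ℝ≥0 => (t : ℝ) * P.real {ω | t * y < Y ω}) atTop (𝓝 (y : ℝ)⁻¹)

/-- A probability measure on `[0,∞)` seen on `[0,∞]` after division by `t`; for `t > 0` and a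
measure `m` this is `A ↦ m (t A)`. -/
noncomputable def rescaleExt (m : ProbabilityMeasure ℝ≥0) (t : ℝ≥0) : ProbabilityMeasure ℝ≥0∞ :=
  m.map (f := fun x : ℝ≥0 => ((x / t : ℝ≥0) : ℝ≥0∞))
    (measurable_coe_nnreal_ennreal.comp (measurable_id.div_const t)).aemeasurable

/-- `K` is in the domain of attraction of `G`: `K(t, t ·) ⇒ G` weakly on `[0,∞]` as `t → ∞`. -/
def KernelInDomain (K : Kernel ℝ≥0 ℝ≥0) [IsMarkovKernel K] (G : ProbabilityMeasure ℝ≥0) : Prop :=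
  Tendsto (fun t : ℝ≥0 => rescaleExt ⟨K t, inferInstance⟩ t) atTop
    (𝓝 (G.map (f := fun x : ℝ≥0 => (x : ℝ≥0∞)) measurable_coe_nnreal_ennreal.aemeasurable))

/-- The measure `A ↦ t P[(X / t, Y / t) ∈ A]` on `[0,∞] × (0,∞]`. (The map along which
the law is pulled back is the inclusion of `[0,∞] × (0,∞]` in `[0,∞] × [0,∞]`, a measurable
embedding.) -/
noncomputable def scaledLaw {Ω : Type*} [MeasurableSpace Ω] (P : Measure Ω) (X Y : Ω → ℝ≥0)
    (t : ℝ≥0) : Measure ExtCone :=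
  t • (P.map (fun ω => (((X ω / t : ℝ≥0) : ℝ≥0∞), ((Y ω / t : ℝ≥0) : ℝ≥0∞)))).comap
    (fun p : ExtCone => (p.1, (p.2 : ℝ≥0∞)))

/-- The set `A × (y,∞]` in `[0,∞] × (0,∞]`. -/
def upperStrip (A : Set ℝ≥0∞) (y : ℝ) : Set ExtCone :=
  {p | p.1 ∈ A ∧ ENNReal.ofReal y < (p.2 : ℝ≥0∞)}

/-- Conditional non-degeneracy: for each `y ∈ (0,∞)` the measure `A ↦ μ (A × (y,∞])` on `[0,∞]` is
not concentrated at a single point, and it gives no mass to `∞`. -/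
def CondNondegenerate (μ : Measure ExtCone) : Prop :=
  ∀ y : ℝ, 0 < y →
    (¬ ∃ c : ℝ≥0∞, μ (upperStrip {c}ᶜ y) = 0) ∧ μ (upperStrip {∞} y) = 0

/-- The distribution function `u ↦ G [0,u]`. -/
noncomputable def distFun (G : ProbabilityMeasure ℝ≥0) (u : ℝ) : ℝ :=
  (G : Measure ℝ≥0).real {z | (z : ℝ) ≤ u}

/-! In the coordinates `(z, u) = (X / Y, Y / t)` the limit is a product measure. Given `Y = y`, the
law of `X / Y` is `K(y, y ·)`. On the event `Y > tδ` the value `y` exceeds `tδ`, so for large `t`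
this law gives a `G`-continuity set nearly its `G`-mass, uniformly in `y`. Meanwhile `t P[Y / t ∈
·]` tends to `u⁻² du`. Hence `t P[(X / Y, Y / t) ∈ ·, Y > tδ]` converges weakly to `G ⊗ u⁻² du` on
heights above `δ` (`tendsto_polarLaw`).

The measure `μ` is the image of `G ⊗ u⁻² du` under `(z, u) ↦ (zu, u)`. A compact subset of the cone
lies above some height `δ > 0`, so a test function becomes a bounded continuous function of `(z,
u)`, and weak convergence above `δ` gives vague convergence.

The formulas for `μ` are Fubini for the set `zu ≤ x`, `u > y`. Slicing at fixed `u` gives the first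
integral. Slicing at fixed `z` gives the expectation of the positive part of `1/y - ξ/x`, which
equals each of the other two expressions. -/

/-- The measure `u⁻² du` on `(0,∞)`, as a measure on `ℝ`. -/
noncomputable def invSqMeasure : Measure ℝ :=
  (volume.restrict (Set.Ioi 0)).withDensity fun u => ENNReal.ofReal (u ^ 2)⁻¹

instance : SFinite invSqMeasure := by unfold invSqMeasure; infer_instance

instance : NullSingletonClass invSqMeasure := by unfold invSqMeasure; infer_instance

lemma measurable_ofReal_inv_sq : Measurable fun u : ℝ => ENNReal.ofReal (u ^ 2)⁻¹ := by fun_prop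

lemma invSqMeasure_restrict_Ioi {a : ℝ} (ha : 0 ≤ a) :
    invSqMeasure.restrict (Set.Ioi a)
      = (volume.restrict (Set.Ioi a)).withDensity fun u => ENNReal.ofReal (u ^ 2)⁻¹ := by
  rw [invSqMeasure, restrict_withDensity measurableSet_Ioi, Measure.restrict_restrict
    measurableSet_Ioi, Set.inter_eq_left.2 (Set.Ioi_subset_Ioi ha)]

lemma invSqMeasure_Ioi {a : ℝ} (ha : 0 < a) :
    invSqMeasure (Set.Ioi a) = ENNReal.ofReal a⁻¹ := by
  have hder : ∀ x ∈ Set.Ici a, HasDerivAt (fun u : ℝ => -u⁻¹) ((x ^ 2)⁻¹) x := by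
    intro x hx
    have hx0 : x ≠ 0 := (ha.trans_le hx).ne'
    simpa using (hasDerivAt_inv hx0).fun_neg
  have hlim : Tendsto (fun u : ℝ => -u⁻¹) atTop (𝓝 0) := by
    simpa using (tendsto_inv_atTop_zero (𝕜 := ℝ)).neg
  have hnn : ∀ x ∈ Set.Ioi a, (0 : ℝ) ≤ (x ^ 2)⁻¹ := fun x _ => by positivity
  have hint := integrableOn_Ioi_deriv_of_nonneg' hder hnn hlim
  have heq := integral_Ioi_of_hasDerivAt_of_nonneg' hder hnn hlim
  rw [← Measure.restrict_apply_self, invSqMeasure_restrict_Ioi ha.le,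
    withDensity_apply _ measurableSet_Ioi, Measure.restrict_restrict measurableSet_Ioi,
    Set.inter_self, ← ofReal_integral_eq_lintegral_ofReal hint
      (ae_of_all _ fun x => by positivity), heq]
  simp

lemma invSqMeasure_Ioc {a b : ℝ} (ha : 0 < a) (hab : a ≤ b) :
    invSqMeasure (Set.Ioc a b) = ENNReal.ofReal (a⁻¹ - b⁻¹) := by
  have hb := ha.trans_le hab
  rw [← Set.Ioi_sdiff_Ioi, measure_sdiff (Set.Ioi_subset_Ioi hab) nullMeasurableSet_Ioi
    (by rw [invSqMeasure_Ioi hb]; exact ENNReal.ofReal_ne_top), invSqMeasure_Ioi ha,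
    invSqMeasure_Ioi hb, ENNReal.ofReal_sub _ (by positivity)]

/-! ### Integration on the cone through extension by zero. -/

/-- The inclusion of `[0,∞] × (0,∞]` in `[0,∞] × [0,∞]`. -/
def coneIncl (p : ExtCone) : ℝ≥0∞ × ℝ≥0∞ := (p.1, (p.2 : ℝ≥0∞))

lemma measurableEmbedding_coneIncl : MeasurableEmbedding coneIncl :=
  MeasurableEmbedding.id.prodMap (MeasurableEmbedding.subtype_coe measurableSet_Ioi)

lemma range_coneIncl : Set.range coneIncl = {q | 0 < q.2} := by
  ext q
  constructor
  · rintro ⟨p, rfl⟩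
    exact p.2.2
  · intro h
    exact ⟨(q.1, ⟨q.2, h⟩), rfl⟩

/-- The function on the cone extended by zero to `[0,∞] × [0,∞]`. -/
noncomputable def coneExtend (f : ExtCone → ℝ) : ℝ≥0∞ × ℝ≥0∞ → ℝ :=
  Function.extend coneIncl f 0

lemma coneExtend_apply (f : ExtCone → ℝ) (a b : ℝ≥0∞) (hb : 0 < b) :
    coneExtend f (a, b) = f (a, ⟨b, hb⟩) :=
  measurableEmbedding_coneIncl.injective.extend_apply f 0 (a, ⟨b, hb⟩)

lemma coneExtend_apply_zero (f : ExtCone → ℝ) (a : ℝ≥0∞) : coneExtend f (a, 0) = 0 := by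
  refine Function.extend_apply' _ _ _ ?_
  rw [← Set.mem_range, range_coneIncl]
  simp

lemma measurable_coneExtend {f : ExtCone → ℝ} (hf : Measurable f) :
    Measurable (coneExtend f) :=
  measurableEmbedding_coneIncl.measurable_extend hf measurable_const

/-- Pulling back and pushing forward along the inclusion restricts to positive heights, and the
extended function vanishes elsewhere. -/
lemma integral_comap_coneIncl {α : Type*} [MeasurableSpace α] (m : Measure α)
    {φ : α → ℝ≥0∞ × ℝ≥0∞} (hφ : Measurable φ) {f : ExtCone → ℝ} (hf : Measurable f) :
    ∫ p, f p ∂((m.map φ).comap coneIncl) = ∫ a, coneExtend f (φ a) ∂m := by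
  have h1 : ∀ p, f p = coneExtend f (coneIncl p) := fun p =>
    (measurableEmbedding_coneIncl.injective.extend_apply f 0 p).symm
  have h2 : ∫ p, f p ∂((m.map φ).comap coneIncl)
      = ∫ q, coneExtend f q ∂(((m.map φ).comap coneIncl).map coneIncl) := by
    rw [measurableEmbedding_coneIncl.integral_map]
    exact integral_congr_ae (ae_of_all _ h1)
  rw [h2, measurableEmbedding_coneIncl.map_comap,
    setIntegral_eq_integral_of_forall_compl_eq_zero,
    integral_map hφ.aemeasurable (measurable_coneExtend hf).aestronglyMeasurable]
  rintro ⟨a, b⟩ hq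
  rw [range_coneIncl] at hq
  obtain rfl : b = 0 := by simpa using hq
  exact coneExtend_apply_zero f a

/-! ### The limit measure: finiteness on strips and regularity. -/

/-- The limit measure: the image of `G ⊗ u⁻² du` under `(z, u) ↦ (z u, u)`. -/
noncomputable def coneLimit (G : ProbabilityMeasure ℝ≥0) : Measure ExtCone :=
  (((G : Measure ℝ≥0).prod invSqMeasure).map
    fun p => ((p.1 : ℝ≥0∞) * ENNReal.ofReal p.2, ENNReal.ofReal p.2)).comap coneIncl

lemma measurable_mul_prodMk_ofReal :
    Measurable fun p : ℝ≥0 × ℝ => ((p.1 : ℝ≥0∞) * ENNReal.ofReal p.2, ENNReal.ofReal p.2) := by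
  fun_prop

lemma coneLimit_upperStrip (G : ProbabilityMeasure ℝ≥0) {A : Set ℝ≥0∞} (hA : MeasurableSet A)
    {y : ℝ} (hy : 0 < y) :
    coneLimit G (upperStrip A y) = ((G : Measure ℝ≥0).prod invSqMeasure)
      {p | (p.1 : ℝ≥0∞) * ENNReal.ofReal p.2 ∈ A ∧ y < p.2} := by
  have himg : coneIncl '' upperStrip A y = A ×ˢ Set.Ioi (ENNReal.ofReal y) := by
    ext q
    constructor
    · rintro ⟨p, hp, rfl⟩
      exact hp
    · rintro ⟨h1, h2⟩
      exact ⟨(q.1, ⟨q.2, pos_of_gt (show _ < q.2 from h2)⟩), ⟨h1, h2⟩, rfl⟩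
  rw [coneLimit, measurableEmbedding_coneIncl.comap_apply, himg,
    Measure.map_apply measurable_mul_prodMk_ofReal (hA.prod measurableSet_Ioi)]
  congr 1
  ext p
  simp only [Set.mem_preimage, Set.mem_prod, Set.mem_Ioi, Set.mem_ofPred_eq]
  rw [ENNReal.ofReal_lt_ofReal_iff_of_nonneg hy.le]

lemma measurableSet_mul_mem_and_lt {A : Set ℝ≥0∞} (hA : MeasurableSet A) (y : ℝ) :
    MeasurableSet {p : ℝ≥0 × ℝ | (p.1 : ℝ≥0∞) * ENNReal.ofReal p.2 ∈ A ∧ y < p.2} := by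
  refine MeasurableSet.inter ?_ (measurableSet_lt measurable_const measurable_snd)
  exact (measurable_fst.comp measurable_mul_prodMk_ofReal) hA

lemma coneLimit_upperStrip_lt_top (G : ProbabilityMeasure ℝ≥0) (A : Set ℝ≥0∞)
    {y : ℝ} (hy : 0 < y) : coneLimit G (upperStrip A y) < ∞ := by
  have hsub : upperStrip A y ⊆ upperStrip Set.univ y := fun p hp => ⟨trivial, hp.2⟩
  refine (measure_mono hsub).trans_lt ?_
  have : {p : ℝ≥0 × ℝ | (p.1 : ℝ≥0∞) * ENNReal.ofReal p.2 ∈ Set.univ ∧ y < p.2}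
      = Set.univ ×ˢ Set.Ioi y := by ext; simp
  rw [coneLimit_upperStrip G .univ hy, this, Measure.prod_prod, invSqMeasure_Ioi hy]
  simp

/-- A compact set of the cone stays away from the horizontal axis. -/
lemma IsCompact.exists_subset_upperStrip {C : Set ExtCone} (hC : IsCompact C) :
    ∃ δ : ℝ≥0, 0 < δ ∧ C ⊆ upperStrip Set.univ δ := by
  rcases C.eq_empty_or_nonempty with rfl | hne
  · exact ⟨1, one_pos, Set.empty_subset _⟩
  have hcont : Continuous fun p : ExtCone => (p.2 : ℝ≥0∞) := by fun_prop
  obtain ⟨p, hp, hmin⟩ := hC.exists_isMinOn hne hcont.continuousOn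
  obtain ⟨δ, h0, hδ⟩ := ENNReal.lt_iff_exists_nnreal_btwn.1 (show 0 < (p.2 : ℝ≥0∞) from p.2.2)
  refine ⟨δ, by simpa using h0, fun q hq => ⟨trivial, ?_⟩⟩
  rw [ENNReal.ofReal_coe_nnreal]
  exact hδ.trans_le (hmin hq)

instance : LocallyCompactSpace (Set.Ioi (0 : ℝ≥0∞)) := isOpen_Ioi.locallyCompactSpace

lemma coneLimit_regular (G : ProbabilityMeasure ℝ≥0) : (coneLimit G).Regular := by
  have : IsFiniteMeasureOnCompacts (coneLimit G) := ⟨fun C hC => by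
    obtain ⟨δ, hδ, hsub⟩ := hC.exists_subset_upperStrip
    exact (measure_mono hsub).trans_lt (coneLimit_upperStrip_lt_top G _ hδ)⟩
  have : IsLocallyFiniteMeasure (coneLimit G) := inferInstance
  infer_instance

/-! ### Explicit formulas for the limit measure. -/

lemma monotone_distFun (G : ProbabilityMeasure ℝ≥0) : Monotone (distFun G) :=
  fun _ _ h => measureReal_mono fun _ hz => le_trans hz h

lemma distFun_nonneg (G : ProbabilityMeasure ℝ≥0) (u : ℝ) : 0 ≤ distFun G u := measureReal_nonneg

lemma ofReal_distFun (G : ProbabilityMeasure ℝ≥0) (u : ℝ) :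
    ENNReal.ofReal (distFun G u) = (G : Measure ℝ≥0) {z | (z : ℝ) ≤ u} := by
  simp [distFun]

lemma coe_mul_ofReal_le_ofReal_iff (z : ℝ≥0) (u : ℝ) {x : ℝ} (hx : 0 ≤ x) :
    (z : ℝ≥0∞) * ENNReal.ofReal u ≤ ENNReal.ofReal x ↔ (z : ℝ) * u ≤ x := by
  rw [← ENNReal.ofReal_coe_nnreal, ← ENNReal.ofReal_mul z.coe_nonneg,
    ENNReal.ofReal_le_ofReal_iff hx]

/-- Fubini with `u` fixed: the slice is `z ≤ x / u`. -/
lemma coneLimit_upperStrip_eq_lintegral_snd (G : ProbabilityMeasure ℝ≥0) {x y : ℝ} (hx : 0 < x)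
    (hy : 0 < y) : coneLimit G (upperStrip (Set.Iic (ENNReal.ofReal x)) y)
      = ∫⁻ u in Set.Ioi y, ENNReal.ofReal (distFun G (x / u) * (u ^ 2)⁻¹) := by
  rw [coneLimit_upperStrip G measurableSet_Iic hy,
    Measure.prod_apply_symm (measurableSet_mul_mem_and_lt measurableSet_Iic y)]
  have h : ∀ u : ℝ, (G : Measure ℝ≥0) ((fun z => (z, u)) ⁻¹'
      {p : ℝ≥0 × ℝ | (p.1 : ℝ≥0∞) * ENNReal.ofReal p.2 ∈ Set.Iic (ENNReal.ofReal x) ∧ y < p.2})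
      = (Set.Ioi y).indicator (fun u => ENNReal.ofReal (distFun G (x / u))) u := by
    intro u
    by_cases hu : y < u
    · rw [Set.indicator_of_mem (Set.mem_Ioi.2 hu), ofReal_distFun]
      congr 1
      ext z
      simp only [Set.mem_preimage, Set.mem_ofPred_eq, Set.mem_Iic, hu, and_true]
      rw [coe_mul_ofReal_le_ofReal_iff _ _ hx.le, le_div_iff₀ (hy.trans hu)]
    · simp [hu]
  have hm : Measurable fun u : ℝ => ENNReal.ofReal (distFun G (x / u)) :=
    ((monotone_distFun G).measurable.comp (measurable_const.div measurable_id)).ennreal_ofReal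
  simp_rw [h]
  rw [lintegral_indicator measurableSet_Ioi, invSqMeasure_restrict_Ioi hy.le,
    lintegral_withDensity_eq_lintegral_mul _ measurable_ofReal_inv_sq hm]
  refine lintegral_congr fun u => ?_
  rw [Pi.mul_apply, mul_comm, ENNReal.ofReal_mul (distFun_nonneg G _)]

/-- Fubini with `z` fixed: the slice is `(y, x / z]`, of mass `1/y - z/x`. `ENNReal.ofReal` supplies
the positive part when the slice is empty. -/
lemma coneLimit_upperStrip_eq_lintegral_fst (G : ProbabilityMeasure ℝ≥0) {x y : ℝ} (hx : 0 < x)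
    (hy : 0 < y) : coneLimit G (upperStrip (Set.Iic (ENNReal.ofReal x)) y)
      = ∫⁻ z, ENNReal.ofReal (y⁻¹ - x⁻¹ * (z : ℝ)) ∂(G : Measure ℝ≥0) := by
  rw [coneLimit_upperStrip G measurableSet_Iic hy,
    Measure.prod_apply (measurableSet_mul_mem_and_lt measurableSet_Iic y)]
  refine lintegral_congr fun z => ?_
  rcases eq_or_ne z 0 with rfl | hz
  · have : Prod.mk (0 : ℝ≥0) ⁻¹' {p : ℝ≥0 × ℝ | (p.1 : ℝ≥0∞) * ENNReal.ofReal p.2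
        ∈ Set.Iic (ENNReal.ofReal x) ∧ y < p.2} = Set.Ioi y := by ext; simp
    rw [this, invSqMeasure_Ioi hy]
    simp
  have hz0 : (0 : ℝ) < z := by positivity
  have : Prod.mk z ⁻¹' {p : ℝ≥0 × ℝ | (p.1 : ℝ≥0∞) * ENNReal.ofReal p.2
        ∈ Set.Iic (ENNReal.ofReal x) ∧ y < p.2} = Set.Ioc y (x / z) := by
    ext u
    simp only [Set.mem_preimage, Set.mem_ofPred_eq, Set.mem_Iic, Set.mem_Ioc]
    rw [coe_mul_ofReal_le_ofReal_iff _ _ hx.le, le_div_iff₀ hz0, mul_comm, and_comm]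
  rw [this]
  have hinv : (x / z)⁻¹ = x⁻¹ * (z : ℝ) := by rw [inv_div, div_eq_inv_mul]
  rcases le_total y (x / z) with h | h
  · rw [invSqMeasure_Ioc hy h, hinv]
  · rw [Set.Ioc_eq_empty h.not_gt, measure_empty, eq_comm, ENNReal.ofReal_eq_zero, ← hinv,
      sub_nonpos]
    exact inv_anti₀ (by positivity) h

/-- Fubini on the set `z ≤ u`. -/
lemma lintegral_Ioc_distFun (G : ProbabilityMeasure ℝ≥0) (b : ℝ) :
    ∫⁻ u in Set.Ioc 0 b, ENNReal.ofReal (distFun G u)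
      = ∫⁻ z, ENNReal.ofReal (b - (z : ℝ)) ∂(G : Measure ℝ≥0) := by
  have hS : MeasurableSet {p : ℝ≥0 × ℝ | (p.1 : ℝ) ≤ p.2} :=
    measurableSet_le (by fun_prop) (by fun_prop)
  have h1 := Measure.prod_apply_symm (μ := (G : Measure ℝ≥0))
    (ν := volume.restrict (Set.Ioc 0 b)) hS
  rw [Measure.prod_apply hS] at h1
  simp_rw [ofReal_distFun]
  refine h1.symm.trans (lintegral_congr fun z => ?_)
  have hz : MeasurableSet (Prod.mk z ⁻¹' {p : ℝ≥0 × ℝ | (p.1 : ℝ) ≤ p.2}) :=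
    measurable_prodMk_left hS
  rw [Measure.restrict_apply hz, ← Real.volume_Icc]
  -- The slice is `[z, b]`, except that it loses the endpoint when `z = 0`; squeezing it between
  -- `(z, b]` and `[z, b]` avoids the case split.
  have hsub : Set.Ioc (z : ℝ) b ⊆ Prod.mk z ⁻¹' {p : ℝ≥0 × ℝ | (p.1 : ℝ) ≤ p.2} ∩ Set.Ioc 0 b :=
    fun u hu => ⟨hu.1.le, z.coe_nonneg.trans_lt hu.1, hu.2⟩
  refine le_antisymm (measure_mono fun u hu => ⟨hu.1, hu.2.2⟩) ?_
  rw [Real.volume_Icc, ← Real.volume_Ioc]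
  exact measure_mono hsub

lemma measureReal_coneLimit_eq_integral_Ioi (G : ProbabilityMeasure ℝ≥0) {x y : ℝ} (hx : 0 < x)
    (hy : 0 < y) : (coneLimit G).real (upperStrip (Set.Iic (ENNReal.ofReal x)) y)
      = ∫ u in Set.Ioi y, distFun G (x / u) * (u ^ 2)⁻¹ := by
  rw [Measure.real, coneLimit_upperStrip_eq_lintegral_snd G hx hy,
    integral_eq_lintegral_of_nonneg_ae]
  · exact ae_of_all _ fun u => mul_nonneg (distFun_nonneg G _) (by positivity)
  · exact (((monotone_distFun G).measurable.comp (measurable_const.div measurable_id)).mul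
      (by fun_prop)).aestronglyMeasurable

lemma measureReal_coneLimit_eq_integral_Ioc (G : ProbabilityMeasure ℝ≥0) {x y : ℝ} (hx : 0 < x)
    (hy : 0 < y) : (coneLimit G).real (upperStrip (Set.Iic (ENNReal.ofReal x)) y)
      = x⁻¹ * ∫ u in Set.Ioc 0 (x / y), distFun G u := by
  rw [integral_eq_lintegral_of_nonneg_ae (ae_of_all _ fun u => distFun_nonneg G u)
    (monotone_distFun G).measurable.aestronglyMeasurable, lintegral_Ioc_distFun, Measure.real,
    coneLimit_upperStrip_eq_lintegral_fst G hx hy, ← ENNReal.toReal_ofReal (inv_pos.2 hx).le,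
    ← ENNReal.toReal_mul, ← lintegral_const_mul' _ _ ENNReal.ofReal_ne_top,
    ENNReal.toReal_ofReal (inv_pos.2 hx).le]
  congr 1
  refine lintegral_congr fun z => ?_
  rw [← ENNReal.ofReal_mul (inv_pos.2 hx).le]
  congr 1
  field_simp

lemma measureReal_coneLimit_eq_sub (G : ProbabilityMeasure ℝ≥0) {x y : ℝ} (hx : 0 < x)
    (hy : 0 < y) : (coneLimit G).real (upperStrip (Set.Iic (ENNReal.ofReal x)) y)
      = y⁻¹ * distFun G (x / y)
        - x⁻¹ * ∫ z in {z : ℝ≥0 | (z : ℝ) ≤ x / y}, (z : ℝ) ∂(G : Measure ℝ≥0) := by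
  set S : Set ℝ≥0 := {z | (z : ℝ) ≤ x / y} with hSdef
  have hS : MeasurableSet S := measurableSet_le (by fun_prop) (by fun_prop)
  have hiff : ∀ z : ℝ≥0, z ∈ S ↔ 0 ≤ y⁻¹ - x⁻¹ * (z : ℝ) := fun z => by
    rw [hSdef, Set.mem_ofPred_eq, sub_nonneg, le_div_iff₀ hy, inv_mul_le_iff₀ hx,
      ← div_eq_mul_inv, le_div_iff₀ hy]
  have hind : ∫⁻ z, ENNReal.ofReal (y⁻¹ - x⁻¹ * (z : ℝ)) ∂(G : Measure ℝ≥0)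
      = ∫⁻ z in S, ENNReal.ofReal (y⁻¹ - x⁻¹ * (z : ℝ)) ∂(G : Measure ℝ≥0) := by
    rw [← lintegral_indicator hS]
    refine lintegral_congr fun z => ?_
    by_cases hz : z ∈ S
    · rw [Set.indicator_of_mem hz]
    · rw [Set.indicator_of_notMem hz, ENNReal.ofReal_eq_zero]
      exact (not_le.1 fun h => hz ((hiff z).2 h)).le
  have hint : IntegrableOn (fun z : ℝ≥0 => (z : ℝ)) S (G : Measure ℝ≥0) := by
    refine Measure.integrableOn_of_bounded (M := x / y) (measure_ne_top _ _)
      (by fun_prop) ?_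
    refine (ae_restrict_iff' hS).2 (ae_of_all _ fun z hz => ?_)
    rwa [Real.norm_of_nonneg z.coe_nonneg]
  have hconst : IntegrableOn (fun _ : ℝ≥0 => y⁻¹) S (G : Measure ℝ≥0) :=
    integrableOn_const (measure_ne_top _ _)
  rw [Measure.real, coneLimit_upperStrip_eq_lintegral_fst G hx hy, hind,
    ← integral_eq_lintegral_of_nonneg_ae
      ((ae_restrict_iff' hS).2 (ae_of_all _ fun z hz => (hiff z).1 hz)) (by fun_prop),
    integral_sub hconst (hint.const_mul _), setIntegral_const, integral_const_mul, smul_eq_mul,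
    mul_comm]
  rfl

/-! ### Conditional non-degeneracy. -/

lemma coneLimit_condNondegenerate (G : ProbabilityMeasure ℝ≥0)
    (hG : (G : Measure ℝ≥0) ≠ Measure.dirac 0) : CondNondegenerate (coneLimit G) := by
  intro y hy
  refine ⟨?_, ?_⟩
  · rintro ⟨c, hc⟩
    rw [coneLimit_upperStrip G (measurableSet_singleton c).compl hy, Measure.measure_prod_null
      (measurableSet_mul_mem_and_lt (measurableSet_singleton c).compl y)] at hc
    have hzero : ∀ᵐ z ∂(G : Measure ℝ≥0), z = 0 := by
      filter_upwards [hc] with z hz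
      by_contra hz0
      -- For `z ≠ 0` at most one `u` satisfies `zu = c`, and `u⁻² du` has no atoms, so the slice
      -- would have the positive mass `1/y`.
      have hsub : Set.Ioi y \ {c.toReal / z} ⊆ Prod.mk z ⁻¹' {p : ℝ≥0 × ℝ |
          (p.1 : ℝ≥0∞) * ENNReal.ofReal p.2 ∈ ({c}ᶜ : Set ℝ≥0∞) ∧ y < p.2} := by
        rintro u ⟨hu, huc⟩
        refine ⟨fun h => huc ?_, hu⟩
        have hz0' : (z : ℝ) ≠ 0 := by exact_mod_cast hz0
        have h' : (z : ℝ≥0∞) * ENNReal.ofReal u = c := h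
        rw [Set.mem_singleton_iff, ← h', ENNReal.toReal_mul,
          ENNReal.toReal_ofReal (hy.trans hu).le, ENNReal.coe_toReal, mul_div_cancel_left₀ _ hz0']
      have h0 := measure_mono_null hsub hz
      rw [measure_sdiff_null (measure_singleton _), invSqMeasure_Ioi hy,
        ENNReal.ofReal_eq_zero] at h0
      exact absurd (inv_pos.2 hy) h0.not_gt
    refine hG ?_
    calc (G : Measure ℝ≥0) = (G : Measure ℝ≥0).map id := Measure.map_id.symm
      _ = (G : Measure ℝ≥0).map (fun _ => 0) := Measure.map_congr hzero
      _ = Measure.dirac 0 := by simp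
  · rw [coneLimit_upperStrip G (measurableSet_singleton ∞) hy]
    have : {p : ℝ≥0 × ℝ | (p.1 : ℝ≥0∞) * ENNReal.ofReal p.2 ∈ ({∞} : Set ℝ≥0∞) ∧ y < p.2} = ∅ := by
      ext p
      simp [ENNReal.mul_eq_top]
    rw [this, measure_empty]

/-! ### Two convergence criteria. -/

/-- Finite measures converge weakly as soon as their total masses converge and they converge along
a π-system containing arbitrarily small neighbourhoods of every point. -/
lemma IsPiSystem.tendsto_finiteMeasure_of_tendsto_of_mem {E ι : Type*} [MeasurableSpace E]
    [TopologicalSpace E] [SecondCountableTopology E] [OpensMeasurableSpace E]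
    {S : Set (Set E)} (hS : IsPiSystem S) {μs : ι → FiniteMeasure E} {μ : FiniteMeasure E}
    {l : Filter ι} [l.IsCountablyGenerated] (hμ : μ ≠ 0)
    (hmeas : ∀ s ∈ S, MeasurableSet s)
    (hnhds : ∀ u : Set E, IsOpen u → ∀ x ∈ u, ∃ s ∈ S, s ∈ 𝓝 x ∧ s ⊆ u)
    (hmass : Tendsto (fun i => (μs i).mass) l (𝓝 μ.mass))
    (h : ∀ s ∈ S, Tendsto (fun i => μs i s) l (𝓝 (μ s))) : Tendsto μs l (𝓝 μ) := by
  have hne : Nonempty E := by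
    by_contra hE
    have : IsEmpty E := not_nonempty_iff.1 hE
    exact hμ (FiniteMeasure.eq_of_forall_apply_eq _ _ fun s _ => by
      rw [Set.eq_empty_of_isEmpty s]; simp)
  have hm0 : μ.mass ≠ 0 := (FiniteMeasure.mass_nonzero_iff μ).2 hμ
  -- Dividing by the total masses, whose limit is nonzero, reduces to the criterion for probability
  -- measures.
  refine FiniteMeasure.tendsto_of_tendsto_normalize_testAgainstNN_of_tendsto_mass ?_ hmass
  refine hS.tendsto_probabilityMeasure_of_tendsto_of_mem hmeas hnhds fun s hs => ?_
  rw [FiniteMeasure.normalize_eq_of_nonzero μ hμ]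
  refine ((hmass.inv₀ hm0).mul (h s hs)).congr' ?_
  filter_upwards [hmass.eventually_ne hm0] with i hi
  rw [FiniteMeasure.normalize_eq_of_nonzero _ ((FiniteMeasure.mass_nonzero_iff _).1 hi)]

lemma tendsto_mul_of_forall_abs_sub_le {ι : Type*} {l : Filter ι} {F L : ι → ℝ} {g c : ℝ}
    (hL : Tendsto L l (𝓝 c))
    (h : ∀ ε : ℝ, 0 < ε → ∀ᶠ i in l, |F i - g * L i| ≤ ε * |L i|) :
    Tendsto F l (𝓝 (g * c)) := by
  have h1 : (fun i => F i - g * L i) =o[l] L :=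
    Asymptotics.isLittleO_iff.2 fun ε hε => h ε hε
  have h2 := (Asymptotics.isLittleO_one_iff ℝ).1 (h1.trans_isBigO (hL.isBigO_one ℝ))
  simpa using h2.add (hL.const_mul g)

/-! ### Weak convergence in the coordinates `(X / Y, Y / t)`. -/

section Polar

variable {Ω : Type*} [MeasurableSpace Ω]

lemma measurable_coe_div {X Y : Ω → ℝ≥0} (hX : Measurable X) (hY : Measurable Y) :
    Measurable fun ω => ((X ω / Y ω : ℝ≥0) : ℝ≥0∞) := (hX.div hY).coe_nnreal_ennreal

/-- Disintegration over `Y`: the joint probability is the integral over `B` of the rescaled kernel's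
mass of `A`, so a bound uniform on `B` integrates. -/
lemma abs_measureReal_div_mem_sub_le {P : Measure Ω} [IsProbabilityMeasure P] {X Y : Ω → ℝ≥0}
    (hY : Measurable Y) {K : Kernel ℝ≥0 ℝ≥0} [IsMarkovKernel K]
    (hK : HasCondDistrib X Y K P) {A : Set ℝ≥0∞} (hA : MeasurableSet A) {B : Set ℝ≥0}
    (hB : MeasurableSet B) {g ε : ℝ}
    (h : ∀ y ∈ B, |((rescaleExt ⟨K y, inferInstance⟩ y : ProbabilityMeasure ℝ≥0∞) :
      Measure ℝ≥0∞).real A - g| ≤ ε) :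
    |P.real {ω | ((X ω / Y ω : ℝ≥0) : ℝ≥0∞) ∈ A ∧ Y ω ∈ B} - g * P.real {ω | Y ω ∈ B}|
      ≤ ε * P.real {ω | Y ω ∈ B} := by
  set S : Set (ℝ≥0 × ℝ≥0) := {p | ((p.2 / p.1 : ℝ≥0) : ℝ≥0∞) ∈ A}
  have hS : MeasurableSet S := measurable_coe_div measurable_snd measurable_fst hA
  have hκ : ∀ y, ((rescaleExt ⟨K y, inferInstance⟩ y : ProbabilityMeasure ℝ≥0∞) :
      Measure ℝ≥0∞).real A = (K y).real (Prod.mk y ⁻¹' S) := fun y => by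
    exact map_measureReal_apply
      (measurable_coe_nnreal_ennreal.comp (measurable_id.div_const y)) hA
  simp_rw [hκ] at h
  have hmeas : Measurable fun y => K y (Prod.mk y ⁻¹' S) :=
    Kernel.measurable_kernel_prodMk_left hS
  have : IsProbabilityMeasure (P.map Y) := Measure.isProbabilityMeasure_map hY.aemeasurable
  have hPB : P.real {ω | Y ω ∈ B} = (P.map Y).real B := (map_measureReal_apply hY hB).symm
  have hPS : P.real {ω | ((X ω / Y ω : ℝ≥0) : ℝ≥0∞) ∈ A ∧ Y ω ∈ B}
      = ∫ y in B, (K y).real (Prod.mk y ⁻¹' S) ∂(P.map Y) := by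
    have hSB : MeasurableSet (S ∩ Prod.fst ⁻¹' B) := hS.inter (measurable_fst hB)
    have h1 := hK.measure_eq (p := (· ∈ S ∩ Prod.fst ⁻¹' B)) hSB
    have h2 : {ω | ((X ω / Y ω : ℝ≥0) : ℝ≥0∞) ∈ A ∧ Y ω ∈ B}
        = {ω | (Y ω, X ω) ∈ S ∩ Prod.fst ⁻¹' B} := rfl
    simp_rw [Measure.real]
    rw [integral_toReal hmeas.aemeasurable (ae_of_all _ fun y => measure_lt_top _ _), h2, h1,
      Set.ofPred_mem_eq, Measure.compProd_apply hSB, ← lintegral_indicator hB]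
    congr 1
    refine lintegral_congr fun y => ?_
    by_cases hy : y ∈ B <;> simp [hy, Set.preimage_preimage]
  have hint : IntegrableOn (fun y => (K y).real (Prod.mk y ⁻¹' S)) B (P.map Y) := by
    refine Measure.integrableOn_of_bounded (M := 1) (measure_ne_top _ _)
      hmeas.ennreal_toReal.aestronglyMeasurable (ae_of_all _ fun y => ?_)
    rw [Real.norm_of_nonneg measureReal_nonneg]
    exact measureReal_le_one
  rw [hPS, hPB, mul_comm g, ← smul_eq_mul ((P.map Y).real B) g, ← setIntegral_const,
    ← integral_sub hint (integrableOn_const (measure_ne_top _ _)), ← Real.norm_eq_abs]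
  exact norm_setIntegral_le_of_norm_le_const (measure_lt_top _ _) h

/-- The law of `(X / Y, Y / t)` on the event `Y > t δ`, multiplied by `t`. -/
noncomputable def polarLaw (P : Measure Ω) [IsProbabilityMeasure P] (X Y : Ω → ℝ≥0) (δ t : ℝ≥0) :
    FiniteMeasure (ℝ≥0∞ × ℝ) :=
  ⟨t • (P.restrict {ω | t * δ < Y ω}).map
    fun ω => (((X ω / Y ω : ℝ≥0) : ℝ≥0∞), ((Y ω / t : ℝ≥0) : ℝ)), inferInstance⟩

instance isFiniteMeasure_invSqMeasure_restrict (δ : ℝ≥0) [h : Fact (0 < δ)] :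
    IsFiniteMeasure (invSqMeasure.restrict (Set.Ioi (δ : ℝ))) :=
  ⟨by rw [Measure.restrict_apply_univ, invSqMeasure_Ioi (NNReal.coe_pos.2 h.out)]
      exact ENNReal.ofReal_lt_top⟩

/-- The law `G` regarded as a law on `[0,∞]`. -/
noncomputable def extLaw (G : ProbabilityMeasure ℝ≥0) : ProbabilityMeasure ℝ≥0∞ :=
  G.map (f := fun x : ℝ≥0 => (x : ℝ≥0∞)) measurable_coe_nnreal_ennreal.aemeasurable

/-- The product of `G` and the measure `u⁻² du` on `(δ,∞)`. -/
noncomputable def polarLimit (G : ProbabilityMeasure ℝ≥0) (δ : ℝ≥0) [Fact (0 < δ)] :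
    FiniteMeasure (ℝ≥0∞ × ℝ) :=
  ⟨(extLaw G : Measure ℝ≥0∞).prod (invSqMeasure.restrict (Set.Ioi (δ : ℝ))), inferInstance⟩

lemma polarLimit_real_prod (G : ProbabilityMeasure ℝ≥0) (δ : ℝ≥0) [Fact (0 < δ)]
    (A : Set ℝ≥0∞) (V : Set ℝ) : (polarLimit G δ : Measure (ℝ≥0∞ × ℝ)).real (A ×ˢ V)
      = (extLaw G : Measure ℝ≥0∞).real A
        * (invSqMeasure.restrict (Set.Ioi (δ : ℝ))).real V := by
  simp [polarLimit, Measure.real, Measure.prod_prod]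

lemma polarLaw_real (P : Measure Ω) [IsProbabilityMeasure P] {X Y : Ω → ℝ≥0} (hX : Measurable X)
    (hY : Measurable Y) (δ t : ℝ≥0) {A : Set ℝ≥0∞} {V : Set ℝ} (hA : MeasurableSet A)
    (hV : MeasurableSet V) : (polarLaw P X Y δ t : Measure (ℝ≥0∞ × ℝ)).real (A ×ˢ V)
      = t * P.real {ω | ((X ω / Y ω : ℝ≥0) : ℝ≥0∞) ∈ A ∧
          (((Y ω / t : ℝ≥0) : ℝ) ∈ V ∧ t * δ < Y ω)} := by
  have hm : Measurable fun ω => (((X ω / Y ω : ℝ≥0) : ℝ≥0∞), ((Y ω / t : ℝ≥0) : ℝ)) :=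
    (measurable_coe_div hX hY).prodMk (hY.div_const t).coe_nnreal_real
  have hAV : MeasurableSet ((fun ω => (((X ω / Y ω : ℝ≥0) : ℝ≥0∞), ((Y ω / t : ℝ≥0) : ℝ))) ⁻¹'
      (A ×ˢ V)) := hm (hA.prod hV)
  simp only [polarLaw, FiniteMeasure.toMeasure_mk, measureReal_nnreal_smul_apply]
  rw [map_measureReal_apply hm (hA.prod hV), measureReal_restrict_apply hAV]
  congr 2
  ext ω
  simp [and_assoc]

/-- The π-system of boxes whose first side has a null frontier. -/
def nullFrontierBoxes (m : Measure ℝ≥0∞) : Set (Set (ℝ≥0∞ × ℝ)) :=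
  {s | ∃ (A : Set ℝ≥0∞) (a b : ℝ), MeasurableSet A ∧ m (frontier A) = 0 ∧ s = A ×ˢ Set.Ioc a b}

lemma isPiSystem_nullFrontierBoxes (m : Measure ℝ≥0∞) : IsPiSystem (nullFrontierBoxes m) := by
  rintro - ⟨A, a, b, hA, hA0, rfl⟩ - ⟨A', a', b', hA', hA0', rfl⟩ -
  exact ⟨A ∩ A', max a a', min b b', hA.inter hA', null_frontier_inter hA0 hA0', by
    rw [Set.prod_inter_prod, Set.Ioc_inter_Ioc]⟩

lemma exists_mem_nullFrontierBoxes (m : Measure ℝ≥0∞) [SFinite m] {U : Set (ℝ≥0∞ × ℝ)}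
    (hU : IsOpen U) {p : ℝ≥0∞ × ℝ} (hp : p ∈ U) :
    ∃ s ∈ nullFrontierBoxes m, s ∈ 𝓝 p ∧ s ⊆ U := by
  obtain ⟨W, hW, V, hV, hWV⟩ := mem_nhds_prod_iff.1 (hU.mem_nhds hp)
  let _ : PseudoMetricSpace ℝ≥0∞ := TopologicalSpace.pseudoMetrizableSpacePseudoMetric ℝ≥0∞
  obtain ⟨ε, hε, hεW⟩ := Metric.mem_nhds_iff.1 hW
  -- Spheres of different radii are disjoint, so arbitrarily small radii give balls with null
  -- frontier.
  obtain ⟨r, hr, hr0⟩ := exists_null_frontier_thickening m {p.1} hε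
  rw [Metric.thickening_singleton] at hr0
  obtain ⟨η, hη, hηV⟩ := Metric.mem_nhds_iff.1 hV
  refine ⟨Metric.ball p.1 r ×ˢ Set.Ioc (p.2 - η / 2) (p.2 + η / 2),
    ⟨_, _, _, Metric.isOpen_ball.measurableSet, hr0, rfl⟩,
    prod_mem_nhds (Metric.ball_mem_nhds _ hr.1) (Ioc_mem_nhds (by linarith) (by linarith)),
    (Set.prod_mono ((Metric.ball_subset_ball hr.2.le).trans hεW) fun u hu => hηV ?_).trans hWV⟩
  rw [Metric.mem_ball, Real.dist_eq, abs_lt]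
  constructor <;> linarith [hu.1, hu.2]

lemma tendsto_mul_measureReal_Ioc {P : Measure Ω} [IsProbabilityMeasure P] {Y : Ω → ℝ≥0}
    (hY : Measurable Y) (hYdom : InStdDomain P Y) {a b : ℝ≥0} (ha : 0 < a) (hab : a ≤ b) :
    Tendsto (fun t : ℝ≥0 => (t : ℝ) * P.real {ω | Y ω ∈ Set.Ioc (t * a) (t * b)}) atTop
      (𝓝 ((a : ℝ)⁻¹ - (b : ℝ)⁻¹)) := by
  refine ((hYdom a ha).sub (hYdom b (ha.trans_le hab))).congr fun t => ?_
  rw [← mul_sub]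
  congr 1
  have hsub : {ω | t * b < Y ω} ⊆ {ω | t * a < Y ω} :=
    fun ω (hω : t * b < Y ω) => (by gcongr : t * a ≤ t * b).trans_lt hω
  rw [← measureReal_sdiff hsub (hY measurableSet_Ioi)]
  congr 1
  ext ω
  simp

/-- Truncation of `(a, b]` at `δ`. The outer `max` keeps the endpoints ordered even when nothing
remains, as `tendsto_mul_measureReal_Ioc` requires. -/
lemma mem_Ioc_and_lt_iff {a b : ℝ} {δ r : ℝ≥0} :
    ((r : ℝ) ∈ Set.Ioc a b ∧ δ < r)
      ↔ r ∈ Set.Ioc (max a.toNNReal δ) (max b.toNNReal (max a.toNNReal δ)) := by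
  simp only [Set.mem_Ioc, max_lt_iff, le_max_iff]
  constructor
  · rintro ⟨⟨h1, h2⟩, h3⟩
    refine ⟨⟨?_, h3⟩, Or.inl (NNReal.le_toNNReal_of_coe_le h2)⟩
    rw [← NNReal.coe_lt_coe, Real.coe_toNNReal']
    exact max_lt h1 (NNReal.coe_pos.2 (pos_of_gt h3))
  · rintro ⟨⟨h1, h3⟩, h2⟩
    refine ⟨⟨(Real.le_coe_toNNReal a).trans_lt (NNReal.coe_lt_coe.2 h1), ?_⟩, h3⟩
    rcases h2 with h2 | h2 | h2
    · exact (Real.le_toNNReal_iff_coe_le' (pos_of_gt h3)).1 h2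
    · exact absurd h2 h1.not_ge
    · exact absurd h2 h3.not_ge

lemma tendsto_polarLaw {P : Measure Ω} [IsProbabilityMeasure P] {X Y : Ω → ℝ≥0}
    (hX : Measurable X) (hY : Measurable Y) {K : Kernel ℝ≥0 ℝ≥0} [IsMarkovKernel K]
    {G : ProbabilityMeasure ℝ≥0} (hK : HasCondDistrib X Y K P) (hYdom : InStdDomain P Y)
    (hKG : KernelInDomain K G) (δ : ℝ≥0) [hδ : Fact (0 < δ)] :
    Tendsto (polarLaw P X Y δ) atTop (𝓝 (polarLimit G δ)) := by
  have hδ0 : 0 < δ := hδ.out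
  have hmass : (polarLimit G δ : Measure (ℝ≥0∞ × ℝ)).real Set.univ = (δ : ℝ)⁻¹ := by
    rw [← Set.univ_prod_univ, polarLimit_real_prod]
    simp [Measure.real, invSqMeasure_Ioi (NNReal.coe_pos.2 hδ0)]
  refine (isPiSystem_nullFrontierBoxes (extLaw G)).tendsto_finiteMeasure_of_tendsto_of_mem
    ?_ ?_ (fun U hU p hp => exists_mem_nullFrontierBoxes _ hU hp) ?_ ?_
  · intro h0
    rw [h0] at hmass
    have : (δ : ℝ)⁻¹ ≠ 0 := inv_ne_zero (NNReal.coe_pos.2 hδ0).ne'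
    exact this (by simpa using hmass.symm)
  · rintro s ⟨A, a, b, hA, -, rfl⟩
    exact hA.prod measurableSet_Ioc
  · rw [← NNReal.tendsto_coe]
    change Tendsto (fun t => (polarLaw P X Y δ t : Measure (ℝ≥0∞ × ℝ)).real Set.univ) atTop
      (𝓝 ((polarLimit G δ : Measure (ℝ≥0∞ × ℝ)).real Set.univ))
    rw [hmass]
    refine (hYdom δ hδ0).congr fun t => ?_
    rw [← Set.univ_prod_univ, polarLaw_real P hX hY δ t .univ .univ]
    simp
  · rintro s ⟨A, a, b, hA, hA0, rfl⟩
    rw [← NNReal.tendsto_coe]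
    change Tendsto (fun t => (polarLaw P X Y δ t : Measure (ℝ≥0∞ × ℝ)).real (A ×ˢ Set.Ioc a b))
      atTop (𝓝 ((polarLimit G δ : Measure (ℝ≥0∞ × ℝ)).real (A ×ˢ Set.Ioc a b)))
    set a' : ℝ≥0 := max a.toNNReal δ with ha'
    set b' : ℝ≥0 := max b.toNNReal a' with hb'
    have ha0 : 0 < a' := hδ0.trans_le (le_max_right _ _)
    have hab : a' ≤ b' := le_max_right _ _
    have hlim : (invSqMeasure.restrict (Set.Ioi (δ : ℝ))).real (Set.Ioc a b)
        = (a' : ℝ)⁻¹ - (b' : ℝ)⁻¹ := by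
      have : Set.Ioc a b ∩ Set.Ioi (δ : ℝ) = Set.Ioc (a' : ℝ) b' := by
        ext r
        by_cases hr : 0 ≤ r
        · lift r to ℝ≥0 using hr
          have h := mem_Ioc_and_lt_iff (a := a) (b := b) (δ := δ) (r := r)
          rw [← ha', ← hb', Set.mem_Ioc, Set.mem_Ioc] at h
          rw [Set.mem_inter_iff, Set.mem_Ioi, Set.mem_Ioc, Set.mem_Ioc, NNReal.coe_lt_coe,
            NNReal.coe_lt_coe, NNReal.coe_le_coe]
          exact h
        · exact ⟨fun h => absurd (δ.coe_nonneg.trans (le_of_lt h.2)) hr,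
            fun h => absurd (a'.coe_nonneg.trans h.1.le) hr⟩
      rw [measureReal_restrict_apply measurableSet_Ioc, this, Measure.real,
        invSqMeasure_Ioc (NNReal.coe_pos.2 ha0) (NNReal.coe_le_coe.2 hab), ENNReal.toReal_ofReal]
      exact sub_nonneg.2 (inv_anti₀ (NNReal.coe_pos.2 ha0) (NNReal.coe_le_coe.2 hab))
    rw [polarLimit_real_prod, hlim]
    refine tendsto_mul_of_forall_abs_sub_le (tendsto_mul_measureReal_Ioc hY hYdom ha0 hab) ?_
    intro ε hε
    have hker := ProbabilityMeasure.tendsto_measure_of_null_frontier_of_tendsto hKG (E := A)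
      (by rw [ProbabilityMeasure.null_iff_toMeasure_null]; exact hA0)
    rw [← NNReal.tendsto_coe, Metric.tendsto_atTop] at hker
    obtain ⟨s₀, hs₀⟩ := hker ε hε
    -- Every `y` in the box exceeds `tδ ≥ s₀`, so the kernel estimate holds uniformly there.
    filter_upwards [eventually_ge_atTop (s₀ / δ), eventually_gt_atTop 0] with t ht ht0
    have hbd := abs_measureReal_div_mem_sub_le hY hK hA
      (measurableSet_Ioc (a := t * a') (b := t * b'))
      (g := (extLaw G : Measure ℝ≥0∞).real A) (ε := ε) fun y hy => by
        refine (hs₀ y ?_).le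
        calc s₀ ≤ t * δ := (div_le_iff₀ hδ0).1 ht
          _ ≤ t * a' := by gcongr; exact le_max_right _ _
          _ ≤ y := hy.1.le
    have hset : {ω | ((X ω / Y ω : ℝ≥0) : ℝ≥0∞) ∈ A ∧
          (((Y ω / t : ℝ≥0) : ℝ) ∈ Set.Ioc a b ∧ t * δ < Y ω)}
        = {ω | ((X ω / Y ω : ℝ≥0) : ℝ≥0∞) ∈ A ∧ Y ω ∈ Set.Ioc (t * a') (t * b')} := by
      ext ω
      have h1 : t * δ < Y ω ↔ δ < Y ω / t := by rw [lt_div_iff₀ ht0, mul_comm]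
      have h2 : Y ω ∈ Set.Ioc (t * a') (t * b') ↔ Y ω / t ∈ Set.Ioc a' b' := by
        rw [Set.mem_Ioc, Set.mem_Ioc, lt_div_iff₀ ht0, div_le_iff₀ ht0, mul_comm a', mul_comm b']
      simp only [Set.mem_ofPred_eq]
      rw [h1, h2, mem_Ioc_and_lt_iff]
    rw [polarLaw_real P hX hY δ t hA measurableSet_Ioc, hset, abs_mul,
      abs_of_nonneg t.coe_nonneg, abs_of_nonneg measureReal_nonneg, mul_left_comm, ← mul_sub,
      abs_mul, abs_of_nonneg t.coe_nonneg, mul_left_comm ε]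
    gcongr

end Polar

/-! ### Back to the cone: from weak to vague convergence. -/

section Vague

/-- A function on the cone in the coordinates `(z, u) ↦ (z u, u)`, frozen below the level `δ`. -/
noncomputable def coneToPolar (f : ExtCone → ℝ) (δ : ℝ≥0) (hδ : 0 < δ) (p : ℝ≥0∞ × ℝ) : ℝ :=
  f (p.1 * ENNReal.ofReal (max p.2 δ), ⟨ENNReal.ofReal (max p.2 δ),
    ENNReal.ofReal_pos.2 ((NNReal.coe_pos.2 hδ).trans_le (le_max_right _ _))⟩)

/-- Multiplication on `[0,∞]` is discontinuous at `(∞, 0)`; freezing the height at `δ > 0` stays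
away from that point. -/
lemma continuous_coneToPolar {f : ExtCone → ℝ} (hf : Continuous f) {δ : ℝ≥0} (hδ : 0 < δ) :
    Continuous (coneToPolar f δ hδ) := by
  have h2 : Continuous fun p : ℝ≥0∞ × ℝ => ENNReal.ofReal (max p.2 δ) :=
    ENNReal.continuous_ofReal.comp (by fun_prop)
  have h1 : Continuous fun p : ℝ≥0∞ × ℝ => p.1 * ENNReal.ofReal (max p.2 δ) := by
    refine continuous_iff_continuousAt.2 fun p => ENNReal.Tendsto.mul continuousAt_fst
      (Or.inr ENNReal.ofReal_ne_top) h2.continuousAt (Or.inl ?_)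
    exact (ENNReal.ofReal_pos.2 ((NNReal.coe_pos.2 hδ).trans_le (le_max_right _ _))).ne'
  exact hf.comp (h1.prodMk (h2.subtype_mk _))

lemma coneExtend_mul_ofReal {f : ExtCone → ℝ} {δ : ℝ≥0} (hδ : 0 < δ)
    (hsub : tsupport f ⊆ upperStrip Set.univ δ) (z : ℝ≥0∞) (u : ℝ) :
    coneExtend f (z * ENNReal.ofReal u, ENNReal.ofReal u)
      = {p : ℝ≥0∞ × ℝ | (δ : ℝ) < p.2}.indicator (coneToPolar f δ hδ) (z, u) := by
  by_cases hu : (δ : ℝ) < u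
  · rw [Set.indicator_of_mem (show (z, u) ∈ {p : ℝ≥0∞ × ℝ | (δ : ℝ) < p.2} from hu),
      coneExtend_apply f _ _ (ENNReal.ofReal_pos.2 (δ.coe_nonneg.trans_lt hu))]
    simp only [coneToPolar, max_eq_left hu.le]
  · rw [Set.indicator_of_notMem (show (z, u) ∉ {p : ℝ≥0∞ × ℝ | (δ : ℝ) < p.2} from hu)]
    rcases le_or_gt u 0 with h0 | h0
    · rw [ENNReal.ofReal_of_nonpos h0, coneExtend_apply_zero]
    · rw [coneExtend_apply f _ _ (ENNReal.ofReal_pos.2 h0)]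
      refine image_eq_zero_of_notMem_tsupport fun hmem => ?_
      have h := (hsub hmem).2
      exact hu ((ENNReal.ofReal_lt_ofReal_iff_of_nonneg δ.coe_nonneg).1 h)

variable {Ω : Type*} [MeasurableSpace Ω]

lemma integral_scaledLaw {P : Measure Ω} [IsProbabilityMeasure P] {X Y : Ω → ℝ≥0}
    (hX : Measurable X) (hY : Measurable Y) {f : ExtCone → ℝ} (hf : Continuous f)
    {δ : ℝ≥0} (hδ : 0 < δ) (hsub : tsupport f ⊆ upperStrip Set.univ δ) {t : ℝ≥0} (ht : 0 < t) :
    ∫ p, f p ∂(scaledLaw P X Y t)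
      = ∫ p, coneToPolar f δ hδ p ∂(polarLaw P X Y δ t : Measure (ℝ≥0∞ × ℝ)) := by
  have hφ : Measurable fun ω => (((X ω / t : ℝ≥0) : ℝ≥0∞), ((Y ω / t : ℝ≥0) : ℝ≥0∞)) :=
    (hX.div_const t).coe_nnreal_ennreal.prodMk (hY.div_const t).coe_nnreal_ennreal
  have hm : Measurable fun ω => (((X ω / Y ω : ℝ≥0) : ℝ≥0∞), ((Y ω / t : ℝ≥0) : ℝ)) :=
    (measurable_coe_div hX hY).prodMk (hY.div_const t).coe_nnreal_real
  have hset : MeasurableSet {ω | t * δ < Y ω} := measurableSet_lt measurable_const hY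
  have hl := integral_comap_coneIncl P hφ hf.measurable
  rw [scaledLaw, integral_smul_nnreal_measure]
  simp only [polarLaw, FiniteMeasure.toMeasure_mk]
  rw [integral_smul_nnreal_measure, integral_map hm.aemeasurable
    (continuous_coneToPolar hf hδ).aestronglyMeasurable, ← integral_indicator hset]
  refine congrArg (t • ·) (hl.trans (integral_congr_ae (ae_of_all _ fun ω => ?_)))
  have hcoe : ((Y ω / t : ℝ≥0) : ℝ≥0∞) = ENNReal.ofReal ((Y ω / t : ℝ≥0) : ℝ) :=
    ENNReal.ofReal_coe_nnreal.symm
  have hiff : (δ : ℝ) < ((Y ω / t : ℝ≥0) : ℝ) ↔ t * δ < Y ω := by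
    rw [NNReal.coe_lt_coe, lt_div_iff₀ ht, mul_comm]
  -- If `Y = 0`, then `X / Y` is `0` by convention and `X / t = (X / Y)(Y / t)` may fail, but both
  -- integrands vanish.
  rcases eq_or_ne (Y ω) 0 with h0 | h0
  · have : ω ∉ {ω | t * δ < Y ω} := by simp [h0]
    rw [Set.indicator_of_notMem this]
    simp [h0, coneExtend_apply_zero]
  have hX' : ((X ω / t : ℝ≥0) : ℝ≥0∞)
      = ((X ω / Y ω : ℝ≥0) : ℝ≥0∞) * ENNReal.ofReal ((Y ω / t : ℝ≥0) : ℝ) := by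
    rw [← hcoe, ← ENNReal.coe_mul, div_mul_div_cancel₀ h0]
  simp only
  rw [hX', hcoe, coneExtend_mul_ofReal hδ hsub]
  by_cases h : t * δ < Y ω
  · rw [Set.indicator_of_mem (show _ ∈ {p : ℝ≥0∞ × ℝ | (δ : ℝ) < p.2} from hiff.2 h),
      Set.indicator_of_mem (show ω ∈ {ω | t * δ < Y ω} from h)]
  · rw [Set.indicator_of_notMem (show _ ∉ {p : ℝ≥0∞ × ℝ | (δ : ℝ) < p.2} from mt hiff.1 h),
      Set.indicator_of_notMem (show ω ∉ {ω | t * δ < Y ω} from h)]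

lemma integral_coneLimit (G : ProbabilityMeasure ℝ≥0) {f : ExtCone → ℝ} (hf : Continuous f)
    {δ : ℝ≥0} [hδ : Fact (0 < δ)] (hsub : tsupport f ⊆ upperStrip Set.univ δ) :
    ∫ p, f p ∂(coneLimit G)
      = ∫ p, coneToPolar f δ hδ.out p ∂(polarLimit G δ : Measure (ℝ≥0∞ × ℝ)) := by
  have hE : MeasurableSet {p : ℝ≥0 × ℝ | (δ : ℝ) < p.2} :=
    measurableSet_lt measurable_const measurable_snd
  have hpol : (polarLimit G δ : Measure (ℝ≥0∞ × ℝ))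
      = (((G : Measure ℝ≥0).prod invSqMeasure).restrict {p | (δ : ℝ) < p.2}).map
        (Prod.map (fun z : ℝ≥0 => (z : ℝ≥0∞)) id) := by
    have : {p : ℝ≥0 × ℝ | (δ : ℝ) < p.2} = Set.univ ×ˢ Set.Ioi (δ : ℝ) := by ext; simp
    rw [this, ← Measure.prod_restrict, Measure.restrict_univ,
      ← Measure.map_prod_map _ _ measurable_coe_nnreal_ennreal measurable_id, Measure.map_id]
    rfl
  rw [coneLimit, integral_comap_coneIncl _ measurable_mul_prodMk_ofReal hf.measurable, hpol,
    integral_map (measurable_coe_nnreal_ennreal.prodMap measurable_id).aemeasurable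
      (continuous_coneToPolar hf hδ.out).aestronglyMeasurable, ← integral_indicator hE]
  refine integral_congr_ae (ae_of_all _ fun p => ?_)
  exact coneExtend_mul_ofReal hδ.out hsub _ _

lemma vagueTendsto_scaledLaw {P : Measure Ω} [IsProbabilityMeasure P] {X Y : Ω → ℝ≥0}
    (hX : Measurable X) (hY : Measurable Y) {K : Kernel ℝ≥0 ℝ≥0} [IsMarkovKernel K]
    {G : ProbabilityMeasure ℝ≥0} (hK : HasCondDistrib X Y K P) (hYdom : InStdDomain P Y)
    (hKG : KernelInDomain K G) : VagueTendsto (scaledLaw P X Y) atTop (coneLimit G) := by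
  intro f hf hcomp
  obtain ⟨δ, hδ, hsub⟩ := IsCompact.exists_subset_upperStrip hcomp
  have : Fact (0 < δ) := ⟨hδ⟩
  obtain ⟨C, hC⟩ := hf.bounded_above_of_compact_support hcomp
  have h := FiniteMeasure.tendsto_iff_forall_integral_tendsto.1
    (tendsto_polarLaw hX hY hK hYdom hKG δ)
    (BoundedContinuousFunction.ofNormedAddCommGroup (coneToPolar f δ hδ)
      (continuous_coneToPolar hf hδ) C fun p => hC _)
  rw [integral_coneLimit G hf hsub]
  refine h.congr' ?_
  filter_upwards [eventually_gt_atTop 0] with t ht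
  exact (integral_scaledLaw hX hY hf hδ hsub ht).symm

end Vague

theorem theorem3p1 {Ω : Type*} [MeasurableSpace Ω] (P : Measure Ω) [IsProbabilityMeasure P]
    (X Y : Ω → ℝ≥0) (hX : Measurable X) (hY : Measurable Y)
    (K : Kernel ℝ≥0 ℝ≥0) [IsMarkovKernel K] (G : ProbabilityMeasure ℝ≥0)
    (hK : HasCondDistrib X Y K P) (hYdom : InStdDomain P Y) (hKG : KernelInDomain K G) :
    ∃ μ : Measure ExtCone,
      μ.Regular ∧
      VagueTendsto (scaledLaw P X Y) atTop μ ∧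
      (∀ x y : ℝ, 0 < x → 0 < y →
        μ (upperStrip (Set.Iic (ENNReal.ofReal x)) y) < ∞ ∧
        μ.real (upperStrip (Set.Iic (ENNReal.ofReal x)) y)
          = ∫ u in Set.Ioi y, distFun G (x / u) * (u ^ 2)⁻¹ ∧
        μ.real (upperStrip (Set.Iic (ENNReal.ofReal x)) y)
          = x⁻¹ * ∫ u in Set.Ioc 0 (x / y), distFun G u ∧
        μ.real (upperStrip (Set.Iic (ENNReal.ofReal x)) y)
          = y⁻¹ * distFun G (x / y)
            - x⁻¹ * ∫ z in {z : ℝ≥0 | (z : ℝ) ≤ x / y}, (z : ℝ) ∂(G : Measure ℝ≥0)) ∧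
      ((G : Measure ℝ≥0) ≠ Measure.dirac 0 → CondNondegenerate μ) := by
  exact ⟨coneLimit G, coneLimit_regular G, vagueTendsto_scaledLaw hX hY hK hYdom hKG,
    fun x y hx hy => ⟨coneLimit_upperStrip_lt_top G _ hy,
      measureReal_coneLimit_eq_integral_Ioi G hx hy,
      measureReal_coneLimit_eq_integral_Ioc G hx hy, measureReal_coneLimit_eq_sub G hx hy⟩,
    coneLimit_condNondegenerate G⟩
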